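/- Consider $\mathbb{R}^4$ with coordinates $(x_1,x_2,y_1,y_2)$ and symplectic form $dx_1\wedge dy_1+dx_2\wedge dy_2$, and let $L_0=\{y_1=y_2=0\}$. A *flat-at-infinity planar Lagrangian* is a (smoothly) embedded Lagrangian submanifold $L\subset\mathbb{R}^4$ that is diffeomorphic to $\mathbb{R}^2$ and agrees with $L_0$ outside a compact subset of $\mathbb{R}^4$. For $a\in\mathbb{R}$ write $L_a=L\cap\{y_2=a\}$ and let $i_a:\mathbb{R}^3\to\{y_2=a\}\subset\mathbb{R}^4$, $i_a(x_1,x_2,y_1)=(x_1,x_2,y_1,a)$. A set $S\subset\mathbb{R}^3$ is a *negative Lagrangian slice* if there are a flat-at-infinity planar Lagrangian $L$ and $a<0$ such that $L$ is transverse to $\{y_2=a\}$ and $L_a=i_a(S)$. Let $\widetilde{\mathcal S}$ be the set of all negative Lagrangian slices together with the empty set. For $S,T\in\widetilde{\mathcal S}$ write $S\vartriangleleft T$ (respectively $S\trianglelefteq T$) if there are a flat-at-infinity planar Lagrangian $L$ and real numbers $a<b<0$ (respectively $a\le b<0$) with $i_a(S)=L_a$ and $i_b(T)=L_b$. Write $S\sim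 T$ if there is a compactly supported area-preserving diffeomorphism $\varphi$ of the $x_1y_1$-plane with $(\varphi\times\mathrm{id})(S)=T$, where $\mathrm{id}$ acts on the coordinate $x_2$. This is an equivalence relation; let $\mathcal S=\widetilde{\mathcal S}/{\sim}$, and define $\mathbf S\vartriangleleft\mathbf T$ (respectively $\mathbf S\trianglelefteq\mathbf T$) for $\mathbf S,\mathbf T\in\mathcal S$ to mean that some representatives $S\in\mathbf S$, $T\in\mathbf T$ satisfy $S\vartriangleleft T$ (respectively $S\trianglelefteq T$). **Proposition.** The relations $\vartriangleleft$ and $\trianglelefteq$ are well-defined on $\mathcal S$, in the following sense. 1. If $S,S',T,T'\in\widetilde{\mathcal S}$, $S\sim S'$ and $T\sim T'$, then $S\vartriangleleft T$ if and only if $S'\vartriangleleft T'$. Consequently, for all $S,T\in\widetilde{\mathcal S}$, $[S]\vartriangleleft[T]$ if and only if $S\vartriangleleft T$. 2. If $S,S',T,T'\in\widetilde{\mathcal S}$, $S\sim S'$, $T\sim T'$ and $S\not\sim T$, then $S\trianglelefteq T$ if and only if $S'\trianglelefteq T'$. For all $S,T\in\widetilde{\mathcal S}$, $[S]\trianglelefteq[T]$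 if and only if $S\trianglelefteq T$ or $S\sim T$. In particular $\trianglelefteq$ on $\mathcal S$ is the reflexive closure of $\vartriangleleft$: for all $\mathbf S,\mathbf T\in\mathcal S$, $\mathbf S\trianglelefteq\mathbf T$ if and only if $\mathbf S\vartriangleleft\mathbf T$ or $\mathbf S=\mathbf T$. -/

import Mathlib

open scoped Manifold ContDiff

namespace LagrangeCobordism

/-- `ℝ⁴` with coordinates `(x₁, x₂, y₁, y₂) = (p 0, p 1, p 2, p 3)`. -/
abbrev R4 : Type := Fin 4 → ℝ

/-- `ℝ³` with coordinates `(x₁, x₂, y₁) = (q 0, q 1, q 2)`. -/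
abbrev R3 : Type := Fin 3 → ℝ

/-- The plane `ℝ²`. As the `x₁y₁`-plane its coordinates are `(x₁, y₁) = (z 0, z 1)`. -/
abbrev Plane : Type := Fin 2 → ℝ

/-- The standard symplectic form `dx₁ ∧ dy₁ + dx₂ ∧ dy₂` on `ℝ⁴`. -/
def symplecticForm (u v : R4) : ℝ :=
  (u 0 * v 2 - u 2 * v 0) + (u 1 * v 3 - u 3 * v 1)

/-- The area form `dx₁ ∧ dy₁` on the `x₁y₁`-plane. -/
def areaForm (u v : Plane) : ℝ :=
  u 0 * v 1 - u 1 * v 0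

/-- The `x₁x₂`-plane `L₀ = {y₁ = y₂ = 0}` in `ℝ⁴`. -/
def zeroSection : Set R4 := {p | p 2 = 0 ∧ p 3 = 0}

/-- `f : ℝ² → ℝ⁴` is a smooth embedding onto `L` (an immersion which is a homeomorphism onto
its image) and its image `L` is Lagrangian. The existence of such an `f` says that `L` is an
embedded Lagrangian submanifold of `ℝ⁴` diffeomorphic to `ℝ²`. -/
structure IsLagrangianParam (f : Plane → R4) (L : Set R4) : Prop where
  smooth : ContDiff ℝ ∞ f
  immersion : ∀ z, Function.Injective (fderiv ℝ f z)
  embedding : Topology.IsEmbedding f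
  range_eq : Set.range f = L
  isotropic : ∀ z u v, symplecticForm (fderiv ℝ f z u) (fderiv ℝ f z v) = 0

/-- A planar Lagrangian: an embedded Lagrangian submanifold of `ℝ⁴` diffeomorphic to `ℝ²`. -/
def IsPlanarLagrangian (L : Set R4) : Prop := ∃ f, IsLagrangianParam f L

/-- A planar Lagrangian that agrees with `L₀` outside a compact subset of `ℝ⁴`. -/
def IsFlatPlanarLagrangian (L : Set R4) : Prop :=
  IsPlanarLagrangian L ∧ ∃ K : Set R4, IsCompact K ∧ L \ K = zeroSection \ K

/-- The hyperplane `{y₂ = a}`. -/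
def level (a : ℝ) : Set R4 := {p | p 3 = a}

/-- The inclusion `i_a : ℝ³ → {y₂ = a} ⊆ ℝ⁴`. -/
def levelInclusion (a : ℝ) (q : R3) : R4 := ![q 0, q 1, q 2, a]

/-- The planar Lagrangian `L` is transverse to `{y₂ = a}`: at each `p` in the intersection,
`T_p L + T_p {y₂ = a} = ℝ⁴`. Here `T_p L` is the range of the derivative of a parametrization
of `L` (it does not depend on the parametrization). -/
def IsTransverseToLevel (L : Set R4) (a : ℝ) : Prop :=
  ∃ f, IsLagrangianParam f L ∧ ∀ z, f z ∈ level a →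
    LinearMap.range (fderiv ℝ f z).toLinearMap ⊔
      LinearMap.ker (LinearMap.proj 3 : R4 →ₗ[ℝ] ℝ) = ⊤

/-- `S` is the slice of `L` at level `a`: `L_a = L ∩ {y₂ = a}` equals `i_a(S)`. -/
def IsSliceAt (L : Set R4) (a : ℝ) (S : Set R3) : Prop :=
  L ∩ level a = levelInclusion a '' S

/-- (Generic) negative Lagrangian slices. That such an `S` is a link, i.e. a compact
one-dimensional submanifold of `ℝ³`, is automatic from transversality and `a ≠ 0`. -/
def IsNegativeSlice (S : Set R3) : Prop :=
  ∃ L : Set R4, ∃ a : ℝ, IsFlatPlanarLagrangian L ∧ a < 0 ∧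
    IsTransverseToLevel L a ∧ IsSliceAt L a S

/-- The set of all negative Lagrangian slices together with the empty set. -/
def Slice : Type := {S : Set R3 // IsNegativeSlice S ∨ S = ∅}

/-- `S ◁ S'`. -/
def CobLT (S S' : Slice) : Prop :=
  ∃ L : Set R4, ∃ a b : ℝ, IsFlatPlanarLagrangian L ∧ a < b ∧ b < 0 ∧
    IsSliceAt L a S.1 ∧ IsSliceAt L b S'.1

/-- `S ⊴ S'`. -/
def CobLE (S S' : Slice) : Prop :=
  ∃ L : Set R4, ∃ a b : ℝ, IsFlatPlanarLagrangian L ∧ a ≤ b ∧ b < 0 ∧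
    IsSliceAt L a S.1 ∧ IsSliceAt L b S'.1

/-- Compactly supported area-preserving diffeomorphisms of the `x₁y₁`-plane. -/
structure IsCompactAreaDiffeo (φ : Plane ≃ₘ[ℝ] Plane) : Prop where
  compact_support : ∃ K : Set Plane, IsCompact K ∧ ∀ z ∉ K, φ z = z
  area_preserving : ∀ z u v, areaForm (fderiv ℝ φ z u) (fderiv ℝ φ z v) = areaForm u v

/-- The map `φ × id` of `ℝ³`, acting by `φ` on `(x₁, y₁)` and by the identity on `x₂`. -/
def prodId (φ : Plane → Plane) (q : R3) : R3 :=
  ![φ ![q 0, q 2] 0, q 1, φ ![q 0, q 2] 1]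

/-- `S₁ ∼ S₂`: some compactly supported area-preserving diffeomorphism `φ` of the
`x₁y₁`-plane satisfies `(φ × id)(S₁) = S₂`. -/
def SliceEquiv (S₁ S₂ : Slice) : Prop :=
  ∃ φ : Plane ≃ₘ[ℝ] Plane, IsCompactAreaDiffeo φ ∧ prodId φ '' S₁.1 = S₂.1

theorem IsCompactAreaDiffeo.refl : IsCompactAreaDiffeo (Diffeomorph.refl 𝓘(ℝ, Plane) Plane ∞) := by
  refine ⟨⟨∅, isCompact_empty, fun z _ => rfl⟩, fun z u v => ?_⟩
  have h : fderiv ℝ (Diffeomorph.refl 𝓘(ℝ, Plane) Plane ∞) z = ContinuousLinearMap.id ℝ Plane :=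
    fderiv_id
  rw [h]
  rfl

theorem diffeo_differentiableAt (φ : Plane ≃ₘ[ℝ] Plane) (z : Plane) :
    DifferentiableAt ℝ φ z :=
  (φ.contDiff.differentiable (by simp)) z

theorem IsCompactAreaDiffeo.trans {φ ψ : Plane ≃ₘ[ℝ] Plane} (hφ : IsCompactAreaDiffeo φ)
    (hψ : IsCompactAreaDiffeo ψ) : IsCompactAreaDiffeo (φ.trans ψ) := by
  obtain ⟨K, hK, hKφ⟩ := hφ.compact_support
  obtain ⟨K', hK', hKψ⟩ := hψ.compact_support
  refine ⟨⟨K ∪ K', hK.union hK', fun z hz => ?_⟩, fun z u v => ?_⟩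
  · simp only [Set.mem_union, not_or] at hz
    rw [Diffeomorph.coe_trans, Function.comp_apply, hKφ z hz.1, hKψ z hz.2]
  · rw [Diffeomorph.coe_trans,
      fderiv_comp z (diffeo_differentiableAt ψ _) (diffeo_differentiableAt φ _)]
    simp only [ContinuousLinearMap.comp_apply]
    rw [hψ.area_preserving, hφ.area_preserving]

theorem IsCompactAreaDiffeo.symm {φ : Plane ≃ₘ[ℝ] Plane} (hφ : IsCompactAreaDiffeo φ) :
    IsCompactAreaDiffeo φ.symm := by
  obtain ⟨K, hK, hKφ⟩ := hφ.compact_support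
  refine ⟨⟨K, hK, fun z hz => ?_⟩, fun z u v => ?_⟩
  · have h := φ.symm_apply_apply z
    rwa [hKφ z hz] at h
  · have h : (fderiv ℝ φ (φ.symm z)).comp (fderiv ℝ φ.symm z) = ContinuousLinearMap.id ℝ Plane := by
      rw [← fderiv_comp z (diffeo_differentiableAt φ _) (diffeo_differentiableAt φ.symm _)]
      have h' : (φ : Plane → Plane) ∘ φ.symm = id := funext φ.apply_symm_apply
      rw [h', fderiv_id]
    have hu : ∀ w, fderiv ℝ φ (φ.symm z) (fderiv ℝ φ.symm z w) = w := fun w =>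
      DFunLike.congr_fun h w
    rw [← hφ.area_preserving (φ.symm z), hu, hu]

theorem prodId_comp (φ ψ : Plane → Plane) : prodId (ψ ∘ φ) = prodId ψ ∘ prodId φ := by
  funext q
  have h : ∀ w : Plane, ![w 0, w 1] = w := fun w => by
    funext i; fin_cases i <;> rfl
  simp [prodId, h]

theorem prodId_id : prodId id = id := by
  funext q i
  fin_cases i <;> simp [prodId]

theorem sliceEquiv_equivalence : Equivalence SliceEquiv where
  refl S := ⟨Diffeomorph.refl 𝓘(ℝ, Plane) Plane ∞, IsCompactAreaDiffeo.refl, by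
    rw [Diffeomorph.coe_refl, prodId_id, Set.image_id]⟩
  symm := by
    rintro S T ⟨φ, hφ, h⟩
    refine ⟨φ.symm, hφ.symm, ?_⟩
    have h' : (φ.symm : Plane → Plane) ∘ φ = id := funext φ.symm_apply_apply
    rw [← h, ← Set.image_comp, ← prodId_comp, h', prodId_id, Set.image_id]
  trans := by
    rintro S T U ⟨φ, hφ, h⟩ ⟨ψ, hψ, h'⟩
    refine ⟨φ.trans ψ, hφ.trans hψ, ?_⟩
    rw [Diffeomorph.coe_trans, prodId_comp, Set.image_comp, h, h']

instance sliceSetoid : Setoid Slice := ⟨SliceEquiv, sliceEquiv_equivalence⟩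

/-- The set of slices modulo compactly supported area-preserving diffeomorphisms of the
`x₁y₁`-plane. -/
abbrev SliceClass : Type := Quotient sliceSetoid

/-- The class of a slice. -/
def Slice.cls (S : Slice) : SliceClass := Quotient.mk sliceSetoid S

/-- The relation `◁` on classes: some representatives are related by `◁`. -/
def ClassLT (X Y : SliceClass) : Prop :=
  ∃ S T : Slice, S.cls = X ∧ T.cls = Y ∧ CobLT S T

/-- The relation `⊴` on classes: some representatives are related by `⊴`. -/
def ClassLE (X Y : SliceClass) : Prop :=
  ∃ S T : Slice, S.cls = X ∧ T.cls = Y ∧ CobLE S T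

end LagrangeCobordism

/-! Everything rests on changing one slice of `L` by `φ × id` while keeping the other slice and
flatness at infinity. Applying `φ × id` to all of `ℝ⁴` would move every slice and also `L₀`, so it
has to be cut off in `y₂` by a symplectic map. Instead of cutting off an isotopy to `φ`, the map `φ
× id` is conjugated by a shear translating `x₁` by `1 / b(y₂) - 1`, where `b` is a bump function at
the level `a`. Near `y₂ = a` the shear is trivial; as `b → 0` the support of `φ` escapes to
infinity, so the conjugate extends smoothly by the identity (`isSymplecticAt_localizedLift`). The
result preserves `y₂` and, as `a < 0`, can be made to fix `L₀` (`exists_change_slice`).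

Two such changes, at the two levels, give invariance of `◁` (`CobLT.congr`). The relation `⊴` adds
only the case of equal levels, where the slices coincide. -/

namespace LagrangeCobordism

/-! ### Symplectic maps and Lagrangian parametrizations -/

/-- `F` is smooth at `p` and its derivative there preserves the symplectic form. -/
def IsSymplecticAt (F : R4 → R4) (p : R4) : Prop :=
  ContDiffAt ℝ ∞ F p ∧
    ∀ v w, symplecticForm (fderiv ℝ F p v) (fderiv ℝ F p w) = symplecticForm v w

theorem IsSymplecticAt.differentiableAt {F : R4 → R4} {p : R4} (hF : IsSymplecticAt F p) :
    DifferentiableAt ℝ F p :=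
  hF.1.differentiableAt (by simp)

theorem isSymplecticAt_id (p : R4) : IsSymplecticAt id p :=
  ⟨contDiffAt_id, fun v w => by simp⟩

theorem IsSymplecticAt.comp {F G : R4 → R4} {p : R4} (hG : IsSymplecticAt G (F p))
    (hF : IsSymplecticAt F p) : IsSymplecticAt (G ∘ F) p := by
  refine ⟨hG.1.comp p hF.1, fun v w => ?_⟩
  rw [fderiv_comp p hG.differentiableAt hF.differentiableAt]
  simp only [ContinuousLinearMap.comp_apply]
  rw [hG.2, hF.2]

theorem IsSymplecticAt.congr {F G : R4 → R4} {p : R4} (hF : IsSymplecticAt F p)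
    (h : G =ᶠ[nhds p] F) : IsSymplecticAt G p :=
  ⟨hF.1.congr_of_eventuallyEq h, by rw [h.fderiv_eq]; exact hF.2⟩

theorem eq_zero_of_symplecticForm {v : R4} (h : ∀ w, symplecticForm v w = 0) : v = 0 := by
  have h0 := h ![1, 0, 0, 0]
  have h1 := h ![0, 1, 0, 0]
  have h2 := h ![0, 0, 1, 0]
  have h3 := h ![0, 0, 0, 1]
  simp [symplecticForm] at h0 h1 h2 h3
  funext i
  fin_cases i <;> simp [h0, h1, h2, h3]

theorem IsSymplecticAt.fderiv_injective {F : R4 → R4} {p : R4} (hF : IsSymplecticAt F p) :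
    Function.Injective (fderiv ℝ F p) := by
  refine (injective_iff_map_eq_zero _).2 fun v hv => eq_zero_of_symplecticForm fun w => ?_
  rw [← hF.2, hv]
  simp [symplecticForm]

theorem IsLagrangianParam.symplectic_comp {f : Plane → R4} {L : Set R4}
    (hf : IsLagrangianParam f L) (Φ : R4 ≃ₜ R4) (hΦ : ∀ p, IsSymplecticAt Φ p) :
    IsLagrangianParam (Φ ∘ f) (Φ '' L) := by
  have hd : ∀ z, fderiv ℝ (Φ ∘ f) z = (fderiv ℝ Φ (f z)).comp (fderiv ℝ f z) := fun z =>
    fderiv_comp z (hΦ _).differentiableAt (hf.smooth.differentiable (by simp) z)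
  refine ⟨(contDiff_iff_contDiffAt.2 fun p => (hΦ p).1).comp hf.smooth, fun z => ?_,
    Φ.isEmbedding.comp hf.embedding, by rw [Set.range_comp, hf.range_eq], fun z v w => ?_⟩
  · rw [hd]
    exact (hΦ _).fderiv_injective.comp (hf.immersion z)
  · rw [hd]
    simp only [ContinuousLinearMap.comp_apply]
    rw [(hΦ _).2, hf.isotropic]

/-! ### Shears and lifts of plane diffeomorphisms -/

/-- The shear `(x₁, x₂, y₁, y₂) ↦ (x₁ + u(y₂), x₂ + u'(y₂) y₁, y₁, y₂)`. -/
noncomputable def shear (u : ℝ → ℝ) (p : R4) : R4 :=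
  ![p 0 + u (p 3), p 1 + deriv u (p 3) * p 2, p 2, p 3]

theorem shear_shear_neg (u : ℝ → ℝ) (p : R4) : shear u (shear (-u) p) = p := by
  funext i
  fin_cases i <;> simp [shear, deriv.neg]

theorem shear_neg_shear (u : ℝ → ℝ) (p : R4) : shear (-u) (shear u p) = p := by
  simpa using shear_shear_neg (-u) p

/-- Lets derivatives be computed coordinate by coordinate, so that preservation of the form becomes
an algebraic identity. -/
theorem fderiv_apply_eq {n : ℕ} {E : Type*} [NormedAddCommGroup E] [NormedSpace ℝ E]
    {F : E → Fin n → ℝ} {p : E} (hF : DifferentiableAt ℝ F p) {i : Fin n} {G : E →L[ℝ] ℝ}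
    (hG : HasFDerivAt (fun q => F q i) G p) (v : E) : fderiv ℝ F p v i = G v :=
  DFunLike.congr_fun ((hasFDerivAt_pi'.1 hF.hasFDerivAt i).unique hG) v

/-- The shear is the time-one map of the Hamiltonian `u(y₂) y₁`. The correction `u'(y₂) y₁` in `x₂`
cancels the term `u' dy₂ ∧ dy₁` produced by translating `x₁`. -/
theorem isSymplecticAt_shear {u : ℝ → ℝ} {p : R4} (hu : ContDiffAt ℝ ∞ u (p 3)) :
    IsSymplecticAt (shear u) p := by
  have hu' : ContDiffAt ℝ ∞ (deriv u) (p 3) :=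
    (hu.fderiv_right (m := ∞) (by simp)).clm_apply contDiffAt_const
  have hc : ∀ i, ContDiffAt ℝ ∞ (fun q : R4 => q i) p := fun i => (contDiff_apply ℝ ℝ i).contDiffAt
  have hs : ContDiffAt ℝ ∞ (shear u) p := by
    refine contDiffAt_pi' fun i => ?_
    fin_cases i
    · exact (hc 0).add (hu.comp p (hc 3))
    · exact (hc 1).add (ContDiffAt.mul (ContDiffAt.comp (g := deriv u) p hu' (hc 3)) (hc 2))
    · exact hc 2
    · exact hc 3
  refine ⟨hs, fun v w => ?_⟩
  have hd : DifferentiableAt ℝ (shear u) p := hs.differentiableAt (by simp)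
  have hp : ∀ i, HasFDerivAt (fun q : R4 => q i) (ContinuousLinearMap.proj i : R4 →L[ℝ] ℝ) p :=
    fun i => hasFDerivAt_apply i p
  have d0 := (hu.differentiableAt (by simp)).hasDerivAt.comp_hasFDerivAt p (hp 3)
  have d1 := (hu'.differentiableAt (by simp)).hasDerivAt.comp_hasFDerivAt p (hp 3)
  have e0 := fderiv_apply_eq hd (i := 0) ((hp 0).add d0)
  have e1 := fderiv_apply_eq hd (i := 1) ((hp 1).add (d1.mul (hp 2)))
  have e2 := fderiv_apply_eq hd (i := 2) (hp 2)
  have e3 := fderiv_apply_eq hd (i := 3) (hp 3)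
  simp only [symplecticForm, e0, e1, e2, e3]
  simp
  ring

/-- The map `φ × id` of `ℝ⁴`, acting by `φ` on `(x₁, y₁)` and by the identity on `(x₂, y₂)`. -/
def planeLift (φ : Plane → Plane) (p : R4) : R4 :=
  ![φ ![p 0, p 2] 0, p 1, φ ![p 0, p 2] 1, p 3]

theorem vec_eta (z : Plane) : ![z 0, z 1] = z := by
  funext i; fin_cases i <;> rfl

theorem planeLift_eq_self {φ : Plane → Plane} {p : R4} (h : φ ![p 0, p 2] = ![p 0, p 2]) :
    planeLift φ p = p := by
  funext i
  fin_cases i <;> simp [planeLift, h]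

theorem planeLift_planeLift_symm (φ : Plane ≃ₘ[ℝ] Plane) (p : R4) :
    planeLift φ (planeLift φ.symm p) = p := by
  funext i
  fin_cases i <;> simp [planeLift, vec_eta]

theorem isSymplecticAt_planeLift {φ : Plane ≃ₘ[ℝ] Plane} (hφ : IsCompactAreaDiffeo φ) (p : R4) :
    IsSymplecticAt (planeLift φ) p := by
  let P : R4 →L[ℝ] Plane :=
    ContinuousLinearMap.pi ![ContinuousLinearMap.proj 0, ContinuousLinearMap.proj 2]
  have hP : ∀ q : R4, P q = ![q 0, q 2] := fun q => by
    funext i; fin_cases i <;> rfl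
  have hlift : planeLift φ = fun q => ![φ (P q) 0, q 1, φ (P q) 1, q 3] := by
    funext q; rw [hP]; rfl
  have hc : ∀ i, ContDiffAt ℝ ∞ (fun q : R4 => q i) p := fun i => (contDiff_apply ℝ ℝ i).contDiffAt
  have hφP : ContDiffAt ℝ ∞ (fun q => φ (P q)) p :=
    (φ.contDiff.comp P.contDiff).contDiffAt
  have hs : ContDiffAt ℝ ∞ (planeLift φ) p := by
    rw [hlift]
    refine contDiffAt_pi' fun i => ?_
    fin_cases i
    · exact contDiffAt_pi.1 hφP 0
    · exact hc 1
    · exact contDiffAt_pi.1 hφP 1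
    · exact hc 3
  refine ⟨hs, fun v w => ?_⟩
  have hd : DifferentiableAt ℝ (planeLift φ) p := hs.differentiableAt (by simp)
  have hp : ∀ i, HasFDerivAt (fun q : R4 => q i) (ContinuousLinearMap.proj i : R4 →L[ℝ] ℝ) p :=
    fun i => hasFDerivAt_apply i p
  have hD : HasFDerivAt (fun q => φ (P q)) ((fderiv ℝ φ (P p)).comp P) p :=
    (diffeo_differentiableAt φ (P p)).hasFDerivAt.comp p P.hasFDerivAt
  rw [hlift] at hd
  have e0 := fderiv_apply_eq hd (i := 0) (hasFDerivAt_pi'.1 hD 0)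
  have e1 := fderiv_apply_eq hd (i := 1) (hp 1)
  have e2 := fderiv_apply_eq hd (i := 2) (hasFDerivAt_pi'.1 hD 1)
  have e3 := fderiv_apply_eq hd (i := 3) (hp 3)
  have harea := hφ.area_preserving (P p) (P v) (P w)
  rw [← hlift] at e0 e1 e2 e3
  simp only [areaForm, hP v, hP w] at harea
  simp only [symplecticForm, e0, e1, e2, e3]
  simp [hP] at harea ⊢
  linarith

/-! ### Cutting off the lift in the `y₂` direction -/

/-- The conjugate of `φ × id` by the shear along `1 / b - 1` where `b(y₂) ≠ 0`, extended by the
identity. As `b(y₂) → 0` the support of `φ` is translated off to infinity. -/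
noncomputable def localizedLift (b : ℝ → ℝ) (φ : Plane → Plane) (p : R4) : R4 :=
  open Classical in
  if b (p 3) = 0 then p
  else shear (fun t => (b t)⁻¹ - 1) (planeLift φ (shear (-fun t => (b t)⁻¹ - 1) p))

theorem localizedLift_of_eq_zero {b : ℝ → ℝ} {p : R4} (h : b (p 3) = 0) (φ : Plane → Plane) :
    localizedLift b φ p = p := if_pos h

theorem localizedLift_of_ne_zero {b : ℝ → ℝ} {p : R4} (h : b (p 3) ≠ 0) (φ : Plane → Plane) :
    localizedLift b φ p =
      shear (fun t => (b t)⁻¹ - 1) (planeLift φ (shear (-fun t => (b t)⁻¹ - 1) p)) := if_neg h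

@[simp]
theorem localizedLift_apply_three (b : ℝ → ℝ) (φ : Plane → Plane) (p : R4) :
    localizedLift b φ p 3 = p 3 := by
  by_cases h : b (p 3) = 0
  · rw [localizedLift_of_eq_zero h]
  · rw [localizedLift_of_ne_zero h]; rfl

theorem localizedLift_localizedLift_symm (b : ℝ → ℝ) (φ : Plane ≃ₘ[ℝ] Plane) (p : R4) :
    localizedLift b φ (localizedLift b φ.symm p) = p := by
  by_cases h : b (p 3) = 0
  · rw [localizedLift_of_eq_zero h, localizedLift_of_eq_zero h]
  · rw [localizedLift_of_ne_zero (by simpa using h), localizedLift_of_ne_zero h, shear_neg_shear,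
      planeLift_planeLift_symm, shear_shear_neg]

/-- Where `b ≠ 0` this is a composition of symplectic maps. Near a point with `b = 0` the
translation is so large that the sheared point misses the support of `φ`, so the map is locally the
identity. -/
theorem isSymplecticAt_localizedLift {b : ℝ → ℝ} (hb : ContDiff ℝ ∞ b) (hb0 : ∀ t, 0 ≤ b t)
    {φ : Plane ≃ₘ[ℝ] Plane} (hφ : IsCompactAreaDiffeo φ) (p : R4) :
    IsSymplecticAt (localizedLift b φ) p := by
  have hcont : Continuous fun q : R4 => b (q 3) := hb.continuous.comp (continuous_apply 3)
  by_cases h : b (p 3) = 0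
  · refine (isSymplecticAt_id p).congr ?_
    obtain ⟨K, hK, hKφ⟩ := hφ.compact_support
    obtain ⟨R, hR0, hR⟩ := hK.isBounded.exists_pos_norm_le
    -- With `x₁ < |p 0| + 1` and `1 / b > R + |p 0| + 2`, the translated coordinate `x₁ - (1 / b -
    -- 1)` is below `-R`, hence outside `K`.
    have hpos : 0 < (R + |p 0| + 2)⁻¹ := by positivity
    have ev1 : ∀ᶠ q : R4 in nhds p, b (q 3) < (R + |p 0| + 2)⁻¹ :=
      hcont.continuousAt.eventually_lt continuousAt_const (by rwa [h])
    have ev2 : ∀ᶠ q : R4 in nhds p, q 0 < |p 0| + 1 :=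
      (continuous_apply 0).continuousAt.eventually_lt continuousAt_const
        (by linarith [le_abs_self (p 0)])
    filter_upwards [ev1, ev2] with q h1 h2
    by_cases hq : b (q 3) = 0
    · exact localizedLift_of_eq_zero hq _
    have hu : R + |p 0| + 2 < (b (q 3))⁻¹ :=
      (lt_inv_comm₀ ((hb0 _).lt_of_ne' hq) (by positivity)).1 h1
    rw [localizedLift_of_ne_zero hq, planeLift_eq_self, shear_shear_neg, id]
    refine hKφ _ fun hz => ?_
    have h3 := (norm_le_pi_norm _ (0 : Fin 2)).trans (hR _ hz)
    have h4 := (abs_le.1 h3).1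
    simp [shear] at h4
    linarith
  · have hu : ContDiffAt ℝ ∞ (fun t => (b t)⁻¹ - 1) (p 3) :=
      (hb.contDiffAt.inv h).sub contDiffAt_const
    have hneg : ContDiffAt ℝ ∞ (-fun t => (b t)⁻¹ - 1) (p 3) := hu.neg
    have hlift : IsSymplecticAt
        (planeLift φ ∘ shear (-fun t => (b t)⁻¹ - 1)) p :=
      (isSymplecticAt_planeLift hφ _).comp (isSymplecticAt_shear hneg)
    have hs : IsSymplecticAt (shear (fun t => (b t)⁻¹ - 1) ∘
        planeLift φ ∘ shear (-fun t => (b t)⁻¹ - 1)) p :=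
      (isSymplecticAt_shear (p := (planeLift φ ∘ shear (-fun t => (b t)⁻¹ - 1)) p) hu).comp hlift
    refine hs.congr ?_
    filter_upwards [hcont.continuousAt.eventually_ne h] with q hq
    exact localizedLift_of_ne_zero hq _

/-- `localizedLift` as a homeomorphism of `ℝ⁴`. -/
noncomputable def localizedLiftHomeomorph {b : ℝ → ℝ} (hb : ContDiff ℝ ∞ b) (hb0 : ∀ t, 0 ≤ b t)
    {φ : Plane ≃ₘ[ℝ] Plane} (hφ : IsCompactAreaDiffeo φ) : R4 ≃ₜ R4 where
  toFun := localizedLift b φ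
  invFun := localizedLift b φ.symm
  left_inv := localizedLift_localizedLift_symm b φ.symm
  right_inv := localizedLift_localizedLift_symm b φ
  continuous_toFun := continuous_iff_continuousAt.2 fun p =>
    (isSymplecticAt_localizedLift hb hb0 hφ p).1.continuousAt
  continuous_invFun := continuous_iff_continuousAt.2 fun p =>
    (isSymplecticAt_localizedLift hb hb0 hφ.symm p).1.continuousAt

/-! ### Effect on flat Lagrangians and their slices -/

/-- `Φ` need not have compact support: fixing `L₀` pointwise suffices, since outside `K ∪ Φ(K)` only
points of `L₀` and their images matter. -/
theorem IsFlatPlanarLagrangian.image {L : Set R4} (hL : IsFlatPlanarLagrangian L) (Φ : R4 ≃ₜ R4)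
    (hΦ : ∀ p, IsSymplecticAt Φ p) (h0 : ∀ p ∈ zeroSection, Φ p = p) :
    IsFlatPlanarLagrangian (Φ '' L) := by
  obtain ⟨⟨f, hf⟩, K, hK, hLK⟩ := hL
  refine ⟨⟨_, hf.symplectic_comp Φ hΦ⟩, K ∪ Φ '' K, hK.union (hK.image Φ.continuous), ?_⟩
  have hmem : ∀ p, p ∉ K → (p ∈ L ↔ p ∈ zeroSection) := fun p hp =>
    ⟨fun h => (hLK.subset ⟨h, hp⟩).1, fun h => (hLK.superset ⟨h, hp⟩).1⟩
  ext p
  simp only [Set.mem_sdiff, Set.mem_union, not_or, and_congr_left_iff, and_imp]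
  intro hpK hpK'
  constructor
  · rintro ⟨q, hq, rfl⟩
    have hq0 := (hmem q fun h => hpK' ⟨q, h, rfl⟩).1 hq
    rwa [h0 q hq0]
  · exact fun hp => ⟨p, (hmem p hpK).2 hp, h0 p hp⟩

theorem IsSliceAt.image {L : Set R4} {t : ℝ} {S : Set R3} (hS : IsSliceAt L t S)
    {F : R4 → R4} (hF : ∀ p, F p 3 = p 3) {G : R3 → R3}
    (hFG : ∀ q, F (levelInclusion t q) = levelInclusion t (G q)) :
    IsSliceAt (F '' L) t (G '' S) := by
  have h : F '' L ∩ level t = F '' (L ∩ level t) := by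
    rw [← Set.image_inter_preimage]
    congr 2
    ext p
    simp [level, hF]
  rw [IsSliceAt, h, hS, Set.image_image, Set.image_image]
  simp only [hFG]

/-- The slice of a flat planar Lagrangian at one negative level can be changed by `φ × id` without
changing the slices at levels at distance at least `ε`. -/
theorem exists_change_slice {L : Set R4} (hL : IsFlatPlanarLagrangian L)
    {φ : Plane ≃ₘ[ℝ] Plane} (hφ : IsCompactAreaDiffeo φ) {a ε : ℝ} (hε : 0 < ε) (ha : a + ε ≤ 0) :
    ∃ L', IsFlatPlanarLagrangian L' ∧
      (∀ S, IsSliceAt L a S → IsSliceAt L' a (prodId φ '' S)) ∧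
      ∀ t S, ε ≤ |t - a| → IsSliceAt L t S → IsSliceAt L' t S := by
  let b : ContDiffBump a := ⟨ε / 2, ε, by positivity, by linarith⟩
  have hbz : ∀ t, ε ≤ |t - a| → b t = 0 := fun t ht =>
    b.zero_of_le_dist (by rwa [Real.dist_eq])
  have hb : ContDiff ℝ ∞ b := b.contDiff
  have hb0 : ∀ t, 0 ≤ b t := fun t => b.nonneg
  refine ⟨_, hL.image (localizedLiftHomeomorph hb hb0 hφ)
    (isSymplecticAt_localizedLift hb hb0 hφ) fun p hp => ?_, fun S hS => ?_, fun t S ht hS => ?_⟩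
  · refine localizedLift_of_eq_zero (hbz _ ?_) _
    -- On `L₀` one has `y₂ = 0`, at distance `-a ≥ ε` from `a`, so `b` vanishes there.
    rw [hp.2]
    exact (le_abs_self _).trans' (by linarith)
  · refine hS.image (localizedLift_apply_three b φ) fun q => ?_
    -- The shear involves both `u` and `u'`, so `b = 1` is needed on a neighbourhood of `a`, not
    -- only at `a`.
    have hev : (fun t => (b t)⁻¹ - 1) =ᶠ[nhds a] fun _ => 0 := by
      filter_upwards [b.eventuallyEq_one] with t ht
      simp [ht]
    have hu : (b a)⁻¹ - 1 = 0 := hev.eq_of_nhds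
    have hu' : deriv (fun t => (b t)⁻¹ - 1) a = 0 := by rw [hev.deriv_eq, deriv_const]
    have hne : b (levelInclusion a q 3) ≠ 0 := fun h => by
      have h' : b a = 0 := h
      simp [h'] at hu
    change localizedLift b φ (levelInclusion a q) = _
    rw [localizedLift_of_ne_zero hne]
    funext i
    fin_cases i <;>
      simp [shear, planeLift, levelInclusion, prodId, deriv.neg, hu', hu]
  · have := hS.image (F := localizedLiftHomeomorph hb hb0 hφ) (localizedLift_apply_three b φ)
      (G := id) fun q => localizedLift_of_eq_zero (hbz _ ht) _
    rwa [Set.image_id] at this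

/-! ### Invariance of the two relations -/

theorem CobLT.congr {S S' T T' : Slice} (hS : SliceEquiv S S') (hT : SliceEquiv T T')
    (h : CobLT S T) : CobLT S' T' := by
  obtain ⟨L, a, b, hL, hab, hb, hLS, hLT⟩ := h
  obtain ⟨φ, hφ, hφS⟩ := hS
  obtain ⟨ψ, hψ, hψT⟩ := hT
  obtain ⟨M, hM, hMa, hMt⟩ := exists_change_slice hL hφ (a := a) (sub_pos.2 hab) (by linarith)
  obtain ⟨N, hN, hNb, hNt⟩ :=
    -- The radius `b - a` protects the slice at `a`, already changed; the radius `-b` protects `L₀`.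
    exists_change_slice hM hψ (a := b) (lt_min (sub_pos.2 hab) (neg_pos.2 hb))
      (by linarith [min_le_right (b - a) (-b)])
  refine ⟨N, a, b, hN, hab, hb, ?_, ?_⟩
  · rw [← hφS]
    refine hNt a _ (min_le_of_left_le ?_) (hMa _ hLS)
    rw [abs_sub_comm]
    exact le_abs_self _
  · rw [← hψT]
    exact hNb _ (hMt b _ (le_abs_self _) hLT)

theorem levelInclusion_injective (a : ℝ) : Function.Injective (levelInclusion a) := by
  intro q r h
  funext i
  fin_cases i
  exacts [congrFun h 0, congrFun h 1, congrFun h 2]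

theorem CobLT.cobLE {S T : Slice} (h : CobLT S T) : CobLE S T := by
  obtain ⟨L, a, b, hL, hab, h⟩ := h
  exact ⟨L, a, b, hL, hab.le, h⟩

theorem CobLE.cobLT_or_eq {S T : Slice} (h : CobLE S T) : CobLT S T ∨ S = T := by
  obtain ⟨L, a, b, hL, hab, hb, hS, hT⟩ := h
  rcases hab.lt_or_eq with hab | rfl
  · exact Or.inl ⟨L, a, b, hL, hab, hb, hS, hT⟩
  · exact Or.inr (Subtype.ext ((levelInclusion_injective a).image_injective
      (hS.symm.trans hT)))

theorem isFlatPlanarLagrangian_zeroSection : IsFlatPlanarLagrangian zeroSection := by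
  let f : Plane →L[ℝ] R4 := ContinuousLinearMap.pi
    ![ContinuousLinearMap.proj 0, ContinuousLinearMap.proj 1, 0, 0]
  let g : R4 →L[ℝ] Plane :=
    ContinuousLinearMap.pi ![ContinuousLinearMap.proj 0, ContinuousLinearMap.proj 1]
  have hgf : Function.LeftInverse g f := fun z => by
    funext i; fin_cases i <;> rfl
  refine ⟨⟨f, f.contDiff, fun z => ?_, hgf.isEmbedding g.continuous f.continuous, ?_,
    fun z u v => ?_⟩, ∅, isCompact_empty, rfl⟩
  · rw [f.fderiv]
    exact hgf.injective
  · ext p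
    constructor
    · rintro ⟨z, rfl⟩
      exact ⟨rfl, rfl⟩
    · rintro ⟨h2, h3⟩
      refine ⟨g p, ?_⟩
      funext i
      fin_cases i
      exacts [rfl, rfl, h2.symm, h3.symm]
  · rw [f.fderiv]
    simp [symplecticForm, f]

/-- A nonempty slice comes with a Lagrangian and a level that serve twice; the empty one is the
slice of `L₀` at level `-1`. -/
theorem CobLE.refl (S : Slice) : CobLE S S := by
  rcases S.2 with ⟨L, a, hL, ha, -, hS⟩ | hS
  · exact ⟨L, a, a, hL, le_rfl, ha, hS, hS⟩
  · have h : IsSliceAt zeroSection (-1) S.1 := by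
      rw [IsSliceAt, hS, Set.image_empty, Set.eq_empty_iff_forall_notMem]
      rintro p ⟨⟨-, h⟩, h'⟩
      rw [level, Set.mem_ofPred_eq, h] at h'
      norm_num at h'
    exact ⟨_, -1, -1, isFlatPlanarLagrangian_zeroSection, le_rfl, by norm_num, h, h⟩

theorem SliceEquiv.symm {S T : Slice} (h : SliceEquiv S T) : SliceEquiv T S :=
  sliceEquiv_equivalence.symm h

theorem SliceEquiv.trans {S T U : Slice} (h : SliceEquiv S T) (h' : SliceEquiv T U) :
    SliceEquiv S U :=
  sliceEquiv_equivalence.trans h h'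

theorem cls_eq_cls_iff {S T : Slice} : S.cls = T.cls ↔ SliceEquiv S T := Quotient.eq

theorem classLT_cls_iff (S T : Slice) : ClassLT S.cls T.cls ↔ CobLT S T := by
  constructor
  · rintro ⟨S', T', hS, hT, h⟩
    exact h.congr (cls_eq_cls_iff.1 hS) (cls_eq_cls_iff.1 hT)
  · exact fun h => ⟨S, T, rfl, rfl, h⟩

/-- Inequivalence rules out equal levels, where `S = T`; what remains is `◁`. -/
theorem CobLE.congr {S S' T T' : Slice} (hS : SliceEquiv S S') (hT : SliceEquiv T T')
    (hST : ¬ SliceEquiv S T) (h : CobLE S T) : CobLE S' T' := by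
  rcases h.cobLT_or_eq with h | rfl
  · exact (h.congr hS hT).cobLE
  · exact absurd (sliceEquiv_equivalence.refl S) hST

theorem classLE_cls_iff (S T : Slice) :
    ClassLE S.cls T.cls ↔ (CobLE S T ∨ SliceEquiv S T) := by
  constructor
  · rintro ⟨S', T', hS, hT, h⟩
    rw [cls_eq_cls_iff] at hS hT
    by_cases hST : SliceEquiv S' T'
    · exact Or.inr (hS.symm.trans (hST.trans hT))
    · exact Or.inl (h.congr hS hT hST)
  · rintro (h | h)
    · exact ⟨S, T, rfl, rfl, h⟩
    · exact ⟨S, S, rfl, cls_eq_cls_iff.2 h, CobLE.refl S⟩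

end LagrangeCobordism

open LagrangeCobordism in
theorem proposition1p2 :
    -- `◁` on slices does not depend on the representatives
    (∀ S S' T T' : Slice, SliceEquiv S S' → SliceEquiv T T' → (CobLT S T ↔ CobLT S' T')) ∧
    -- hence `◁` on classes may be tested on any representatives
    (∀ S T : Slice, ClassLT S.cls T.cls ↔ CobLT S T) ∧
    -- between inequivalent slices, `⊴` does not depend on the representatives
    (∀ S S' T T' : Slice, SliceEquiv S S' → SliceEquiv T T' → ¬ SliceEquiv S T →
      (CobLE S T ↔ CobLE S' T')) ∧
    -- `⊴` on classes may be tested on any representatives, and each class is related to itself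
    (∀ S T : Slice, ClassLE S.cls T.cls ↔ (CobLE S T ∨ SliceEquiv S T)) ∧
    -- `⊴` on classes is the reflexive closure of `◁` on classes
    (∀ X Y : SliceClass, ClassLE X Y ↔ (ClassLT X Y ∨ X = Y)) := by
  refine ⟨fun S S' T T' hS hT => ⟨fun h => h.congr hS hT, fun h => h.congr hS.symm hT.symm⟩,
    classLT_cls_iff, fun S S' T T' hS hT hST => ⟨fun h => h.congr hS hT hST, fun h =>
      h.congr hS.symm hT.symm fun h' => hST (hS.trans (h'.trans hT.symm))⟩,
    classLE_cls_iff, fun X Y => ?_⟩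
  induction X using Quotient.inductionOn with | _ S
  induction Y using Quotient.inductionOn with | _ T
  change ClassLE S.cls T.cls ↔ ClassLT S.cls T.cls ∨ S.cls = T.cls
  rw [classLE_cls_iff, classLT_cls_iff, cls_eq_cls_iff]
  constructor
  · rintro (h | h)
    · rcases h.cobLT_or_eq with h | rfl
      exacts [Or.inl h, Or.inr (sliceEquiv_equivalence.refl S)]
    · exact Or.inr h
  · exact Or.imp_left CobLT.cobLE
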